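/- **Proposition 6.14.** For a simplicial group $G$ and $n\ge 0$ put $\pi_n(G)=\bigl(\bigcap_{j}\ker d_j\bigr)/d_0\bigl(\bigcap_{j\neq 0}\ker (d_j\colon G_{n+1}\to G_n)\bigr)$, where the first intersection is taken over all faces $d_j\colon G_n\to G_{n-1}$ (and equals $G_0$ for $n=0$). Call $G$ a $K(A,n)$ if $\pi_n(G)\cong A$ and $\pi_m(G)=1$ for all $m\ne n$. Call $G$ *minimal* if its underlying simplicial set is minimal, i.e. it is a Kan complex in which, for all $n\ge 1$, $0\le k\le n$ and all $n$-simplices $x,y$, if $d_ix=d_iy$ for all $i\ne k$ then $d_kx=d_ky$. The loop simplicial group $\Omega G$ has $(\Omega G)_n=\{x\in G_{n+1} : d_0x=1,\ d_1d_2\cdots d_{n+1}x=1\}$, with faces and degeneracies the restrictions of $d_{i+1}$ and $s_{i+1}$. Let $G$ be a minimal simplicial group that is reduced ($G_0=1$), and suppose that its dimensionwise abelianization $G^{ab}$ is a minimal simplicial group $K(\pi,1)$ for a cyclic group $\pi$. Then $\Omega G$ is an abelian simplicial group, and $G$ is homotopy equivalent, as a simplicial set, to a product of Eilenberg–MacLane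 spaces; precisely, there are simplicial abelian groups $E_n$ $(n\ge 1)$, with $E_n$ a $K(\pi_n(G),n)$, and a simplicial homotopy equivalence $G\simeq\prod_{n\ge1}E_n$. -/

import Mathlib

open CategoryTheory CategoryTheory.Limits Opposite Simplicial

universe u v

noncomputable section

namespace SimplicialGroup

/-! ### Simplicial sets: minimality and homotopy equivalence -/

/-- A simplicial set is minimal if it is a Kan complex in which any two simplices of the same
positive dimension that agree on all faces but the `k`-th also agree on the `k`-th face. -/
structure IsMinimal (X : SSet.{u}) : Prop where
  kan : SSet.KanComplex X
  face_eq : ∀ (n : ℕ) (k : Fin (n + 2)) (x y : X _⦋n + 1⦌),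
    (∀ i : Fin (n + 2), i ≠ k → X.δ i x = X.δ i y) → X.δ k x = X.δ k y

/-- Homotopy equivalence of simplicial sets: mutually inverse maps up to simplicial homotopies
`X ⊗ Δ[1] ⟶ X` and `Y ⊗ Δ[1] ⟶ Y`. (This is the usual notion between Kan complexes.) -/
def HomotopyEquivalent (X Y : SSet.{u}) : Prop :=
  ∃ (f : X ⟶ Y) (g : Y ⟶ X),
    Nonempty (SSet.Homotopy (f ≫ g) (𝟙 X)) ∧ Nonempty (SSet.Homotopy (g ≫ f) (𝟙 Y))

/-! ### Simplicial groups -/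

/-- The underlying simplicial set of a simplicial group. -/
def toSSet (G : SimplicialObject GrpCat.{u}) : SSet.{u} :=
  ((SimplicialObject.whiskering GrpCat.{u} (Type u)).obj (forget GrpCat.{u})).obj G

/-- The simplicial group underlying a simplicial abelian group. -/
def ofComm (A : SimplicialObject CommGrpCat.{u}) : SimplicialObject GrpCat.{u} :=
  ((SimplicialObject.whiskering CommGrpCat.{u} GrpCat.{u}).obj
    (forget₂ CommGrpCat.{u} GrpCat.{u})).obj A

/-- The dimensionwise abelianization of a simplicial group. -/
def abelianization (G : SimplicialObject GrpCat.{u}) : SimplicialObject CommGrpCat.{u} :=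
  ((SimplicialObject.whiskering GrpCat.{u} CommGrpCat.{u}).obj GrpCat.abelianize.{u}).obj G

variable (G : SimplicialObject GrpCat.{u})

/-- The `n`-th group of the Moore complex: the intersection of the kernels of the faces `d_j`
with `j ≠ 0`. -/
def moore (n : ℕ) : Subgroup (G _⦋n⦌) :=
  match n with
  | 0 => ⊤
  | m + 1 => ⨅ (j : Fin (m + 2)) (_ : j ≠ 0), (G.δ j).hom.ker

/-- The cycles in dimension `n`: the intersection of the kernels of all faces. -/
def cycles (n : ℕ) : Subgroup (G _⦋n⦌) :=
  match n with
  | 0 => ⊤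
  | m + 1 => ⨅ j : Fin (m + 2), (G.δ j).hom.ker

/-- The boundaries in dimension `n`: the image of the `(n + 1)`-st group of the Moore complex
under the face `d_0`. -/
def boundaries (n : ℕ) : Subgroup (G _⦋n⦌) :=
  (moore G (n + 1)).map (G.δ 0).hom

instance moore_normal (n : ℕ) : (moore G n).Normal := by
  cases n with
  | zero => exact Subgroup.normal_of_characteristic ⊤
  | succ n =>
    refine Subgroup.normal_iInf_normal fun j => Subgroup.normal_iInf_normal fun _ => ?_
    infer_instance

instance boundaries_normal (n : ℕ) : (boundaries G n).Normal := by
  refine (moore_normal G (n + 1)).map _ fun y => ⟨G.σ 0 y, ?_⟩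
  exact ConcreteCategory.congr_hom (G.δ_comp_σ_self (i := (0 : Fin (n + 1)))) y

/-- The `n`-th homotopy group of a simplicial group (based at the identity): cycles modulo
boundaries. -/
abbrev homotopyGroup (n : ℕ) : Type u :=
  cycles G n ⧸ (boundaries G n).subgroupOf (cycles G n)

/-- The simplicial group `G` is an Eilenberg-MacLane space `K(A, n)`: its `n`-th homotopy group
is isomorphic to `A` and all its other homotopy groups vanish. -/
def IsEilenbergMacLane (A : Type v) [Group A] (n : ℕ) : Prop :=
  Nonempty (homotopyGroup G n ≃* A) ∧ ∀ m : ℕ, m ≠ n → Subsingleton (homotopyGroup G m)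

/-! ### The loop simplicial group -/

/-- The monotone map `[m + 1] → [n + 1]` obtained from `θ : [m] → [n]` by adjoining a new least
vertex: `0 ↦ 0` and `i + 1 ↦ θ i + 1`. -/
def consHom {m n : SimplexCategory} (θ : m ⟶ n) : ⦋m.len + 1⦌ ⟶ ⦋n.len + 1⦌ :=
  SimplexCategory.mkHom
    { toFun := Fin.cons 0 fun i => (θ.toOrderHom i).succ
      monotone' := by
        intro i j h
        induction i using Fin.cases with
        | zero => simp
        | succ i =>
          induction j using Fin.cases with
          | zero => exact absurd h (by simp)
          | succ j =>
            simpa using θ.toOrderHom.monotone (Fin.succ_le_succ_iff.mp h) }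

lemma consHom_id (m : SimplexCategory) : consHom (𝟙 m) = 𝟙 ⦋m.len + 1⦌ := by
  ext i : 3
  induction i using Fin.cases <;> rfl

lemma consHom_comp {l m n : SimplexCategory} (θ : l ⟶ m) (η : m ⟶ n) :
    consHom (θ ≫ η) = consHom θ ≫ consHom η := by
  ext i : 3
  induction i using Fin.cases <;> rfl

lemma δ_zero_consHom {m n : SimplexCategory} (θ : m ⟶ n) :
    SimplexCategory.δ 0 ≫ consHom θ =
      (SimplexCategory.mkHom θ.toOrderHom : ⦋m.len⦌ ⟶ ⦋n.len⦌) ≫ SimplexCategory.δ 0 := by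
  ext i : 3
  rfl

lemma const_zero_consHom {m n : SimplexCategory} (θ : m ⟶ n) :
    SimplexCategory.const ⦋0⦌ ⦋m.len + 1⦌ 0 ≫ consHom θ =
      SimplexCategory.const ⦋0⦌ ⦋n.len + 1⦌ 0 := by
  ext i : 3
  rfl

/-- The loops in dimension `n`: the elements `x` of `G_{n+1}` with `d_0 x = 1` whose initial
vertex `d_1 d_2 ⋯ d_{n+1} x` is trivial (the latter is automatic when `G_0` is trivial). -/
def loopSubgroup (n : ℕ) : Subgroup (G _⦋n + 1⦌) :=
  (G.δ 0).hom.ker ⊓ (G.map (SimplexCategory.const ⦋0⦌ ⦋n + 1⦌ 0).op).hom.ker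

lemma map_mem_loopSubgroup {m n : SimplexCategory} (θ : m ⟶ n) {x : G _⦋n.len + 1⦌}
    (hx : x ∈ loopSubgroup G n.len) :
    (G.map (consHom θ).op).hom x ∈ loopSubgroup G m.len := by
  obtain ⟨h0, h1⟩ := hx
  constructor
  · have h := ConcreteCategory.congr_hom (congrArg (fun f => G.map f.op) (δ_zero_consHom θ)) x
    simp only [op_comp, Functor.map_comp] at h
    refine MonoidHom.mem_ker.mpr (h.trans ?_)
    exact (congrArg _ (MonoidHom.mem_ker.mp h0)).trans (map_one (G.map (SimplexCategory.mkHom θ.toOrderHom).op).hom)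
  · have h := ConcreteCategory.congr_hom (congrArg (fun f => G.map f.op) (const_zero_consHom θ)) x
    simp only [op_comp, Functor.map_comp] at h
    exact MonoidHom.mem_ker.mpr (h.trans (MonoidHom.mem_ker.mp h1))

/-- The loop simplicial group `ΩG`: the fibre over the identity of the path fibration
`d_0 : PG → G`. Its `n`-simplices are the loops in `G_{n+1}`, and its faces and degeneracies are
the restrictions of `d_{i+1}` and `s_{i+1}`. -/
def loop : SimplicialObject GrpCat.{u} where
  obj n := GrpCat.of (loopSubgroup G n.unop.len)
  map {n m} θ := GrpCat.ofHom
    (((G.map (consHom θ.unop).op).hom.comp (loopSubgroup G n.unop.len).subtype).codRestrict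
      (loopSubgroup G m.unop.len) fun x => map_mem_loopSubgroup G θ.unop x.2)
  map_id n := by
    ext x
    change (G.map (consHom (𝟙 n.unop)).op).hom x.1 = x.1
    rw [consHom_id, op_id, G.map_id]
    rfl
  map_comp {n m l} θ η := by
    ext x
    change (G.map (consHom (η.unop ≫ θ.unop)).op).hom x.1 =
      (G.map (consHom η.unop).op).hom ((G.map (consHom θ.unop).op).hom x.1)
    rw [consHom_comp, op_comp, G.map_comp]
    rfl

end SimplicialGroup

end

/-!
Minimality of a simplicial group `G` says that an element with all faces but one trivial is a cycle
(`FaceTrivial`); hence the homotopy groups are the groups of cycles.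

**The loop group is abelian.** Let `G` be reduced and minimal. Cycles of positive dimension are then
central (`FaceTrivial.cycles_le_center`): moving the vertices of a simplex one at a time does not
change its commutator with a cycle, and all of them can be moved to the only vertex. If moreover the
abelianization of `G` has homotopy in dimension one only, the cycles of dimension at least two lie
in the commutator subgroups, and being central they are redundant as generators, so `G` is generated
by `G_1` under the simplicial operators (`FaceTrivial.closure_act_eq_top`). Therefore `ker d_0` in
`G_n` is the normal closure of the elements `e(a)`, the images of `a ∈ G_1` under the map
`[n] → [1]` that separates `0` from the other vertices. On the other hand `ker d_0` is generated by
cycles and by the elements `s_j y` with `j ≥ 1` and `y ∈ ker d_0`, and `e(a)` commutes with both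
kinds, by centrality and by induction on `n`. So `ker d_0` is abelian
(`FaceTrivial.commute_of_face_zero`).

**The splitting.** For reduced `G` the twisting function `x ↦ x (s_0 d_0 x)⁻¹` identifies the
simplicial set `G` with the classifying complex `W̄(ΩG)`, which is a simplicial abelian group as soon
as `ΩG` is abelian. Transported to `G`, its group structure is the recursively defined
multiplication `compMul`, and `LoopCommutative.straighten` is the resulting simplicial abelian
group. Its underlying simplicial set is that of `G`, so it is again minimal, and it has the same
homotopy groups. A minimal simplicial abelian group is the direct product of the simplicial
subgroups generated by its cycles in the various dimensions (`FaceTrivial.cycleComponentIso`): this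
is the Dold-Kan decomposition for a normalized complex with zero differential. Each factor is an
Eilenberg-MacLane space, since a nontrivial cycle is never a product of degenerate elements
(`eq_one_of_mem_degenFrom`). The homotopy equivalence obtained is even an isomorphism.
-/

namespace SimplicialGroup

open scoped commutatorElement

variable {G : SimplicialObject GrpCat.{u}}

/-! ### Simplicial operators on elements -/

variable (G) in
/-- The homomorphism `G_n → G_m` by which a monotone map `θ : [m] → [n]` acts on a simplicial
group. -/
def act {m n : ℕ} (θ : ⦋m⦌ ⟶ ⦋n⦌) : G _⦋n⦌ →* G _⦋m⦌ := (G.map θ.op).hom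

variable (G) in
/-- The face homomorphism `d_i`. -/
abbrev face {n : ℕ} (i : Fin (n + 2)) : G _⦋n + 1⦌ →* G _⦋n⦌ := act G (SimplexCategory.δ i)

variable (G) in
/-- The degeneracy homomorphism `s_i`. -/
abbrev degen {n : ℕ} (i : Fin (n + 1)) : G _⦋n⦌ →* G _⦋n + 1⦌ := act G (SimplexCategory.σ i)

lemma act_id {n : ℕ} (x : G _⦋n⦌) : act G (𝟙 ⦋n⦌) x = x := by
  simp [act]

lemma act_act {l m n : ℕ} (θ : ⦋l⦌ ⟶ ⦋m⦌) (η : ⦋m⦌ ⟶ ⦋n⦌) (x : G _⦋n⦌) :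
    act G θ (act G η x) = act G (θ ≫ η) x := by
  simp [act]

lemma face_face {n : ℕ} {i j : Fin (n + 2)} (h : i ≤ j) (x : G _⦋n + 2⦌) :
    face G i (face G j.succ x) = face G j (face G i.castSucc x) := by
  simp only [act_act, SimplexCategory.δ_comp_δ h]

lemma face_degen_of_le {n : ℕ} {i : Fin (n + 2)} {j : Fin (n + 1)} (h : i ≤ j.castSucc)
    (x : G _⦋n + 1⦌) : face G i.castSucc (degen G j.succ x) = degen G j (face G i x) := by
  simp only [act_act, SimplexCategory.δ_comp_σ_of_le h]

lemma face_degen_self {n : ℕ} (i : Fin (n + 1)) (x : G _⦋n⦌) :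
    face G i.castSucc (degen G i x) = x := by
  rw [act_act, SimplexCategory.δ_comp_σ_self, act_id]

lemma face_degen_succ {n : ℕ} (i : Fin (n + 1)) (x : G _⦋n⦌) :
    face G i.succ (degen G i x) = x := by
  rw [act_act, SimplexCategory.δ_comp_σ_succ, act_id]

lemma face_degen_of_gt {n : ℕ} {i : Fin (n + 2)} {j : Fin (n + 1)} (h : j.castSucc < i)
    (x : G _⦋n + 1⦌) : face G i.succ (degen G j.castSucc x) = degen G j (face G i x) := by
  simp only [act_act, SimplexCategory.δ_comp_σ_of_gt h]

lemma degen_degen {n : ℕ} {i j : Fin (n + 1)} (h : i ≤ j) (x : G _⦋n⦌) :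
    degen G i.castSucc (degen G j x) = degen G j.succ (degen G i x) := by
  simp only [act_act, SimplexCategory.σ_comp_σ h]

lemma face_zero_degen_zero {n : ℕ} (x : G _⦋n⦌) : face G 0 (degen G 0 x) = x :=
  face_degen_self 0 x

/-! ### Cycles in a minimal simplicial group -/

variable (G) in
/-- The group-theoretic content of minimality: an element all of whose faces but one are trivial
has trivial remaining face. -/
def FaceTrivial : Prop :=
  ∀ (n : ℕ) (k : Fin (n + 2)) (x : G _⦋n + 1⦌),
    (∀ i, i ≠ k → face G i x = 1) → face G k x = 1

lemma IsMinimal.faceTrivial (h : IsMinimal (toSSet G)) : FaceTrivial G := by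
  intro n k x hx
  refine (h.face_eq n k x (1 : G _⦋n + 1⦌) fun i hi => ?_).trans (map_one (face G k))
  exact (hx i hi).trans (map_one (face G i)).symm

lemma mem_cycles_succ {n : ℕ} {x : G _⦋n + 1⦌} : x ∈ cycles G (n + 1) ↔ ∀ i, face G i x = 1 := by
  simp only [cycles, Subgroup.mem_iInf]
  rfl

lemma mem_moore_succ {n : ℕ} {x : G _⦋n + 1⦌} :
    x ∈ moore G (n + 1) ↔ ∀ i, i ≠ 0 → face G i x = 1 := by
  simp only [moore, Subgroup.mem_iInf]
  rfl

lemma FaceTrivial.boundaries_eq_bot (h : FaceTrivial G) (n : ℕ) : boundaries G n = ⊥ := by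
  rw [eq_bot_iff]
  rintro _ ⟨x, hx, rfl⟩
  exact h n 0 x (mem_moore_succ.1 hx)

/-- In a minimal simplicial group the homotopy groups are the groups of cycles. -/
def FaceTrivial.homotopyGroupEquiv (h : FaceTrivial G) (n : ℕ) :
    homotopyGroup G n ≃* cycles G n :=
  (QuotientGroup.quotientMulEquivOfEq (by rw [h.boundaries_eq_bot]; simp)).trans
    QuotientGroup.quotientBot

/-- A subgroup of `G_{n+1}` that contains the cycles and suitable degenerate elements contains
every element whose first `m` faces are trivial: dividing `x` by `s_m d_m x` makes one more face
trivial, until all faces but the last are. -/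
lemma FaceTrivial.mem_of_face_eq_one (h : FaceTrivial G) {n : ℕ} (S : Subgroup (G _⦋n + 1⦌))
    (hc : cycles G (n + 1) ≤ S) (m : ℕ)
    (hs : ∀ (j : Fin (n + 1)) (x : G _⦋n + 1⦌), m ≤ j.val →
      (∀ i : Fin (n + 2), i.val < m → face G i x = 1) → degen G j (face G j.castSucc x) ∈ S)
    (x : G _⦋n + 1⦌) (hx : ∀ i : Fin (n + 2), i.val < m → face G i x = 1) : x ∈ S := by
  by_cases hm : m ≤ n
  · let j : Fin (n + 1) := ⟨m, by omega⟩
    have hsx := hs j x le_rfl hx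
    have key : x * (degen G j (face G j.castSucc x))⁻¹ ∈ S := by
      refine FaceTrivial.mem_of_face_eq_one h S hc (m + 1) (fun j' x' hj' hx' =>
        hs j' x' (by omega) fun i hi => hx' i (by omega)) _ fun i hi => ?_
      rw [map_mul, map_inv]
      rcases Nat.lt_succ_iff_lt_or_eq.1 hi with hi | hi
      · rw [hx i hi, one_mul, inv_eq_one]
        obtain ⟨n, rfl⟩ : ∃ k, n = k + 1 := ⟨n - 1, by omega⟩
        obtain ⟨i, rfl⟩ : ∃ i' : Fin (n + 2), i = i'.castSucc := ⟨⟨i.val, by omega⟩, rfl⟩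
        have hi' : i.val < m := hi
        let j' : Fin (n + 1) := ⟨m - 1, by omega⟩
        have hj : j = j'.succ := by
          ext; simp only [j, j', Fin.val_succ]; omega
        have hij : i ≤ j'.castSucc := by
          rw [Fin.le_def]; simp only [j', Fin.val_castSucc]; omega
        rw [hj, face_degen_of_le hij, Fin.castSucc_succ, face_face hij, hx _ hi, map_one, map_one]
      · have : i = j.castSucc := by ext; simpa [j] using hi
        rw [this, face_degen_self, mul_inv_cancel]
    simpa using S.mul_mem key hsx
  · refine hc (mem_cycles_succ.2 ?_)
    have hlast : face G (Fin.last (n + 1)) x = 1 := by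
      refine h n _ x fun i hi => hx i ?_
      have := Fin.val_lt_last hi
      omega
    intro i
    by_cases hi : i = Fin.last (n + 1)
    · rw [hi, hlast]
    · have := Fin.val_lt_last hi
      exact hx i (by omega)
termination_by n + 1 - m

/-! ### Centrality of cycles -/

lemma face_degen_eq_one {n : ℕ} {c : G _⦋n + 1⦌} (hc : c ∈ cycles G (n + 1))
    {k : Fin (n + 3)} {i : Fin (n + 2)} (h₁ : k ≠ i.castSucc) (h₂ : k ≠ i.succ) :
    face G k (degen G i c) = 1 := by
  rw [mem_cycles_succ] at hc
  rw [Ne, Fin.ext_iff, Fin.val_castSucc] at h₁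
  rw [Ne, Fin.ext_iff, Fin.val_succ] at h₂
  rcases lt_or_gt_of_ne h₁ with h | h
  · obtain ⟨j, rfl⟩ : ∃ j : Fin (n + 1), i = j.succ :=
      ⟨⟨i.val - 1, by omega⟩, by ext; simp only [Fin.val_succ]; omega⟩
    obtain ⟨k, rfl⟩ : ∃ k' : Fin (n + 2), k = k'.castSucc := ⟨⟨k.val, by omega⟩, rfl⟩
    simp only [Fin.val_succ, Fin.val_castSucc] at h
    rw [face_degen_of_le (by rw [Fin.le_def, Fin.val_castSucc]; omega), hc, map_one]
  · obtain ⟨j, rfl⟩ : ∃ j : Fin (n + 1), i = j.castSucc := ⟨⟨i.val, by omega⟩, rfl⟩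
    obtain ⟨k, rfl⟩ : ∃ k' : Fin (n + 2), k = k'.succ :=
      ⟨⟨k.val - 1, by omega⟩, by ext; simp only [Fin.val_succ]; omega⟩
    simp only [Fin.val_succ, Fin.val_castSucc] at h h₂
    rw [face_degen_of_gt (by rw [Fin.lt_def, Fin.val_castSucc]; omega), hc, map_one]

/-- Adjacent faces of one simplex have the same commutator with a cycle `c`: these commutators are
the only nontrivial faces of `⁅s_i c, y⁆`, so they represent the same homotopy class. -/
lemma FaceTrivial.commutator_face_eq (h : FaceTrivial G) {n : ℕ} {c : G _⦋n + 1⦌}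
    (hc : c ∈ cycles G (n + 1)) (i : Fin (n + 2)) (y : G _⦋n + 2⦌) :
    ⁅c, face G i.castSucc y⁆ = ⁅c, face G i.succ y⁆ := by
  have hc' : ⁅c, face G i.castSucc y⁆ ∈ cycles G (n + 1) := by
    rw [mem_cycles_succ] at hc ⊢
    intro k
    rw [map_commutatorElement, hc, commutatorElement_one_left]
  have key := h (n + 1) i.succ (⁅degen G i c, y⁆ * (degen G i ⁅c, face G i.castSucc y⁆)⁻¹) ?_
  · rw [map_mul, map_inv, map_commutatorElement, face_degen_succ, face_degen_succ,
      mul_inv_eq_one] at key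
    exact key.symm
  · intro k hk
    rw [map_mul, map_inv, map_commutatorElement]
    by_cases hk' : k = i.castSucc
    · rw [hk', face_degen_self, face_degen_self, mul_inv_cancel]
    · rw [face_degen_eq_one hc hk' hk, face_degen_eq_one hc' hk' hk, commutatorElement_one_left,
        inv_one, mul_one]

lemma hom_ext_val {m n : ℕ} {θ η : ⦋m⦌ ⟶ ⦋n⦌}
    (h : ∀ i : Fin (m + 1), (θ.toOrderHom i).val = (η.toOrderHom i).val) : θ = η := by
  ext i : 3
  exact Fin.ext (h i)

lemma comp_toOrderHom_apply {l m n : ℕ} (θ : ⦋l⦌ ⟶ ⦋m⦌) (η : ⦋m⦌ ⟶ ⦋n⦌) (i : Fin (l + 1)) :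
    (θ ≫ η).toOrderHom i = η.toOrderHom (θ.toOrderHom i) := rfl

lemma val_δ {n : ℕ} (k : Fin (n + 2)) (i : Fin (n + 1)) :
    ((SimplexCategory.δ k).toOrderHom i).val = if i.val < k.val then i.val else i.val + 1 := by
  change (k.succAbove i).val = _
  rw [Fin.succAbove]
  simp only [Fin.lt_def, Fin.val_castSucc]
  split_ifs <;> rfl

lemma val_σ {n : ℕ} (k : Fin (n + 1)) (i : Fin (n + 2)) :
    ((SimplexCategory.σ k).toOrderHom i).val = if i.val ≤ k.val then i.val else i.val - 1 := by
  change (k.predAbove i).val = _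
  rw [Fin.predAbove]
  simp only [Fin.lt_def, Fin.val_castSucc]
  split_ifs <;> first | rfl | omega

/-- The monotone map `[n] → [n]` that collapses the vertices below `k` to `0` and fixes the
others. -/
def collapseHom (n k : ℕ) : ⦋n⦌ ⟶ ⦋n⦌ :=
  SimplexCategory.mkHom
    { toFun := fun i => ⟨if i.val < k then 0 else i.val, by split_ifs <;> omega⟩
      monotone' := by
        intro i j hij
        simp only [Fin.le_def] at hij ⊢
        split_ifs <;> omega }

lemma val_collapseHom {n k : ℕ} (i : Fin (n + 1)) :
    ((collapseHom n k).toOrderHom i).val = if i.val < k then 0 else i.val := rfl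

/-- The monotone map `[n + 1] → [n]` whose faces opposite to `k` and `k + 1` are two consecutive
collapsing maps. -/
def collapseHomotopy (n k : ℕ) : ⦋n + 1⦌ ⟶ ⦋n⦌ :=
  SimplexCategory.mkHom
    { toFun := fun i => ⟨if i.val ≤ k then 0 else i.val - 1, by split_ifs <;> omega⟩
      monotone' := by
        intro i j hij
        simp only [Fin.le_def] at hij ⊢
        split_ifs <;> omega }

lemma val_collapseHomotopy {n k : ℕ} (i : Fin (n + 2)) :
    ((collapseHomotopy n k).toOrderHom i).val = if i.val ≤ k then 0 else i.val - 1 := rfl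

lemma δ_castSucc_collapseHomotopy {n : ℕ} (k : Fin (n + 1)) :
    SimplexCategory.δ k.castSucc ≫ collapseHomotopy n k.val = collapseHom n k.val := by
  refine hom_ext_val fun i => ?_
  rw [comp_toOrderHom_apply, val_collapseHomotopy, val_δ, val_collapseHom, Fin.val_castSucc]
  split_ifs <;> omega

lemma δ_succ_collapseHomotopy {n : ℕ} (k : Fin (n + 1)) :
    SimplexCategory.δ k.succ ≫ collapseHomotopy n k.val = collapseHom n (k.val + 1) := by
  refine hom_ext_val fun i => ?_
  rw [comp_toOrderHom_apply, val_collapseHomotopy, val_δ, val_collapseHom, Fin.val_succ]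
  split_ifs <;> omega

/-- In a reduced minimal simplicial group all cycles of positive dimension are central: the
identity of `[n]` is connected to a constant map by single-vertex moves, so that any commutator
with a cycle equals the commutator with a degenerate image of `G_0 = 1`. -/
lemma FaceTrivial.cycles_le_center (h : FaceTrivial G) (h₀ : Subsingleton (G _⦋0⦌)) (n : ℕ) :
    cycles G (n + 1) ≤ Subgroup.center (G _⦋n + 1⦌) := by
  intro c hc
  rw [Subgroup.mem_center_iff]
  intro y
  have step : ∀ k ≤ n + 2, ⁅c, act G (collapseHom (n + 1) k) y⁆ = ⁅c, y⁆ := by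
    intro k
    induction k with
    | zero =>
      intro _
      have : collapseHom (n + 1) 0 = 𝟙 _ := by
        refine hom_ext_val fun i => ?_
        rw [val_collapseHom, if_neg (Nat.not_lt_zero _)]
        rfl
      rw [this, act_id]
    | succ k ih =>
      intro hk
      rw [← ih (by omega)]
      have := h.commutator_face_eq hc ⟨k, by omega⟩ (act G (collapseHomotopy (n + 1) k) y)
      rw [act_act, act_act] at this
      rw [← δ_succ_collapseHomotopy ⟨k, by omega⟩, ← δ_castSucc_collapseHomotopy ⟨k, by omega⟩]
      exact this.symm
  have hconst : collapseHom (n + 1) (n + 2) =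
      SimplexCategory.const ⦋n + 1⦌ ⦋0⦌ 0 ≫ SimplexCategory.const ⦋0⦌ ⦋n + 1⦌ 0 := by
    refine hom_ext_val fun i => ?_
    rw [val_collapseHom, if_pos i.2]
    rfl
  have := step (n + 2) le_rfl
  rw [hconst, ← act_act, Subsingleton.elim (act G (SimplexCategory.const ⦋0⦌ ⦋n + 1⦌ 0) y) 1,
    map_one, commutatorElement_one_right, eq_comm, commutatorElement_eq_one_iff_mul_comm] at this
  exact this.symm

/-! ### Generation by one-dimensional elements -/

/-- If the cycles of `G_{n+1}` are products of commutators, then they are redundant generators: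
`G_{n+1}` is generated by the central cycles and a subgroup `S` containing the degenerate
elements, whence `[G_{n+1}, G_{n+1}] = [S, S] ≤ S`. -/
lemma FaceTrivial.eq_top_of_degen_mem (h : FaceTrivial G) (h₀ : Subsingleton (G _⦋0⦌)) {n : ℕ}
    (hcomm : cycles G (n + 1) ≤ commutator (G _⦋n + 1⦌)) (S : Subgroup (G _⦋n + 1⦌))
    (hS : ∀ (j : Fin (n + 1)) (y : G _⦋n⦌), degen G j y ∈ S) : S = ⊤ := by
  have hsup : S ⊔ cycles G (n + 1) = ⊤ := by
    rw [eq_top_iff]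
    intro x _
    exact h.mem_of_face_eq_one _ le_sup_right 0
      (fun j y _ _ => le_sup_left (a := S) (hS j _)) x (by simp)
  have hcen := h.cycles_le_center h₀ n
  have hnormal : (cycles G (n + 1)).Normal := ⟨fun c hc g => by
    rw [(Subgroup.mem_center_iff.1 (hcen hc)) g, mul_inv_cancel_right]
    exact hc⟩
  have hle : commutator (G _⦋n + 1⦌) ≤ S := by
    rw [commutator_def, Subgroup.commutator_le]
    intro x _ y _
    have hx : x ∈ S ⊔ cycles G (n + 1) := hsup ▸ Subgroup.mem_top x
    have hy : y ∈ S ⊔ cycles G (n + 1) := hsup ▸ Subgroup.mem_top y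
    obtain ⟨s, hs, c, hc, rfl⟩ := Subgroup.mem_sup_of_normal_right.1 hx
    obtain ⟨t, ht, d, hd, rfl⟩ := Subgroup.mem_sup_of_normal_right.1 hy
    have hc' := Subgroup.mem_center_iff.1 (hcen hc)
    have hd' := Subgroup.mem_center_iff.1 (hcen hd)
    have : ⁅s * c, t * d⁆ = ⁅s, t⁆ := by
      have e : (s * c) * (t * d) = (s * t) * (d * c) := by
        rw [mul_assoc, mul_assoc, ← hc' (t * d), mul_assoc]
      have e' : (t * d) * (s * c) = (t * s) * (d * c) := by
        rw [mul_assoc, mul_assoc, ← mul_assoc d, ← hd' s, mul_assoc]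
      rw [commutatorElement_def, commutatorElement_def, mul_assoc _ _⁻¹ _⁻¹, ← mul_inv_rev, e, e',
        mul_assoc _ _⁻¹ _⁻¹, ← mul_inv_rev]
      group
    rw [this, commutatorElement_def]
    exact S.mul_mem (S.mul_mem (S.mul_mem hs ht) (S.inv_mem hs)) (S.inv_mem ht)
  rw [← hsup, sup_eq_left.2 (hcomm.trans hle)]

/-- A reduced minimal simplicial group whose cycles of dimension at least two are products of
commutators is generated by its one-dimensional elements under the simplicial operators. -/
lemma FaceTrivial.closure_act_eq_top (h : FaceTrivial G) (h₀ : Subsingleton (G _⦋0⦌))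
    (hcomm : ∀ n, cycles G (n + 2) ≤ commutator (G _⦋n + 2⦌)) (n : ℕ) :
    Subgroup.closure {x : G _⦋n + 1⦌ | ∃ (θ : ⦋n + 1⦌ ⟶ ⦋1⦌) (a : G _⦋1⦌), act G θ a = x} = ⊤ := by
  induction n with
  | zero =>
    rw [eq_top_iff]
    intro x _
    exact Subgroup.subset_closure ⟨𝟙 _, x, act_id x⟩
  | succ n ih =>
    refine h.eq_top_of_degen_mem h₀ (hcomm n) _ fun j y => ?_
    rw [← Subgroup.mem_comap]
    have hy : y ∈ (⊤ : Subgroup (G _⦋n + 1⦌)) := Subgroup.mem_top y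
    rw [← ih] at hy
    refine (Subgroup.closure_le _).2 ?_ hy
    rintro _ ⟨θ, a, rfl⟩
    exact Subgroup.subset_closure ⟨SimplexCategory.σ j ≫ θ, a, (act_act _ _ _).symm⟩

/-- If the dimensionwise abelianization is minimal with trivial homotopy in dimension `n + 1`, then
all cycles of dimension `n + 1` are products of commutators. -/
lemma cycles_le_commutator (n : ℕ) (h : FaceTrivial (ofComm (abelianization G)))
    (hn : Subsingleton (homotopyGroup (ofComm (abelianization G)) (n + 1))) :
    cycles G (n + 1) ≤ commutator (G _⦋n + 1⦌) := by
  intro x hx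
  rw [mem_cycles_succ] at hx
  have : Subsingleton (cycles (ofComm (abelianization G)) (n + 1)) :=
    (h.homotopyGroupEquiv (n + 1)).symm.toEquiv.subsingleton
  let x' : (ofComm (abelianization G)) _⦋n + 1⦌ := Abelianization.of x
  have hmem : x' ∈ cycles (ofComm (abelianization G)) (n + 1) := by
    rw [mem_cycles_succ]
    intro i
    exact (congrArg (Abelianization.of (G := G _⦋n⦌)) (hx i)).trans (map_one _)
  have h1 : x' = 1 :=
    congrArg Subtype.val (Subsingleton.elim (α := cycles (ofComm (abelianization G)) (n + 1))
      ⟨_, hmem⟩ 1)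
  rw [← Abelianization.ker_of]
  exact MonoidHom.mem_ker.2 h1

/-! ### Commutativity of the loop group -/

/-- The monotone map `[n] → [1]` with `0` as the only vertex sent to `0`. -/
def initialEdgeHom (n : ℕ) : ⦋n⦌ ⟶ ⦋1⦌ :=
  SimplexCategory.mkHom
    { toFun := fun i => ⟨if i.val = 0 then 0 else 1, by split_ifs <;> omega⟩
      monotone' := by
        intro i j hij
        simp only [Fin.le_def] at hij ⊢
        split_ifs <;> omega }

lemma val_initialEdgeHom {n : ℕ} (i : Fin (n + 1)) :
    ((initialEdgeHom n).toOrderHom i).val = if i.val = 0 then 0 else 1 := rfl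

lemma σ_succ_initialEdgeHom {n : ℕ} (j : Fin (n + 1)) :
    SimplexCategory.σ j.succ ≫ initialEdgeHom (n + 1) = initialEdgeHom (n + 2) := by
  refine hom_ext_val fun i => ?_
  rw [comp_toOrderHom_apply, val_initialEdgeHom, val_initialEdgeHom, val_σ, Fin.val_succ]
  split_ifs <;> omega

/-- A map `[n + 1] → [1]` that separates the vertices `0` and `1` is the initial edge map; every
other one factors through `s_0`. -/
lemma eq_initialEdgeHom_or {n : ℕ} (θ : ⦋n + 1⦌ ⟶ ⦋1⦌) :
    θ = initialEdgeHom (n + 1) ∨ θ = SimplexCategory.σ 0 ≫ SimplexCategory.δ 0 ≫ θ := by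
  have hmono : ∀ i j : Fin (n + 2), i ≤ j → (θ.toOrderHom i).val ≤ (θ.toOrderHom j).val :=
    fun i j hij => θ.toOrderHom.monotone hij
  have hlt : ∀ i : Fin (n + 2), (θ.toOrderHom i).val < 2 := fun i => (θ.toOrderHom i).2
  by_cases h : (θ.toOrderHom (0 : Fin (n + 2))).val = (θ.toOrderHom (1 : Fin (n + 2))).val
  · right
    refine hom_ext_val fun i => ?_
    have key : (SimplexCategory.δ 0).toOrderHom ((SimplexCategory.σ (0 : Fin (n + 1))).toOrderHom i)
        = if i = 0 then (1 : Fin (n + 2)) else i := by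
      refine Fin.ext ?_
      rw [val_δ, val_σ]
      by_cases hi : i = 0
      · simp [hi]
      · have hi' : i.val ≠ 0 := fun h => hi (Fin.ext h)
        rw [if_neg hi, Fin.val_zero, Fin.val_zero, if_neg (by omega), if_neg (by omega)]
        omega
    rw [comp_toOrderHom_apply, comp_toOrderHom_apply, key]
    split_ifs with hi
    · rw [hi, h]
    · rfl
  · left
    refine hom_ext_val fun i => ?_
    rw [val_initialEdgeHom]
    have h01 := hmono 0 1 (Fin.zero_le _)
    have h1 := hlt 1
    split_ifs with hi
    · rw [show i = 0 from Fin.ext hi]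
      omega
    · have := hmono 1 i (by rw [Fin.le_def, Fin.val_one]; omega)
      have := hlt i
      omega

lemma face_zero_act_initialEdgeHom (h₀ : Subsingleton (G _⦋0⦌)) {n : ℕ} (a : G _⦋1⦌) :
    face G 0 (act G (initialEdgeHom (n + 1)) a) = 1 := by
  have : SimplexCategory.δ 0 ≫ initialEdgeHom (n + 1) =
      SimplexCategory.const ⦋n⦌ ⦋0⦌ 0 ≫ SimplexCategory.const ⦋0⦌ ⦋1⦌ 1 := by
    refine hom_ext_val fun i => ?_
    rw [comp_toOrderHom_apply, val_initialEdgeHom, val_δ]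
    exact if_neg (by simp)
  rw [act_act, this, ← act_act, Subsingleton.elim (act G (SimplexCategory.const ⦋0⦌ ⦋1⦌ 1) a) 1,
    map_one]

/-- The elements with trivial `d_0` commute. Such elements of dimension `n` are generated by the
conjugates of the elements `e(a)`, the images of `a ∈ G_1` under the initial edge map, and `e(a)` is
central among them: modulo central cycles each of them is a product of elements `s_j y` with
`j ≥ 1`, and `e(a)` is itself of the form `s_j e'(a)`, so induction on the dimension applies. -/
lemma FaceTrivial.commute_of_face_zero (h : FaceTrivial G) (h₀ : Subsingleton (G _⦋0⦌))
    (hcomm : ∀ n, cycles G (n + 2) ≤ commutator (G _⦋n + 2⦌)) (n : ℕ) (x y : G _⦋n + 1⦌)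
    (hx : face G 0 x = 1) (hy : face G 0 y = 1) : x * y = y * x := by
  induction n with
  | zero =>
    have hyc : y ∈ cycles G 1 := mem_cycles_succ.2 fun i => Subsingleton.elim _ _
    exact Subgroup.mem_center_iff.1 (h.cycles_le_center h₀ 0 hyc) x
  | succ n ih =>
    let L : Subgroup (G _⦋n + 2⦌) := (face G 0).ker
    let C : Subgroup (G _⦋n + 2⦌) := Subgroup.centralizer L
    have hedge : ∀ a : G _⦋1⦌, act G (initialEdgeHom (n + 2)) a ∈ C := by
      intro a
      rw [Subgroup.mem_centralizer_iff]
      intro z hz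
      have := h.mem_of_face_eq_one (Subgroup.centralizer {act G (initialEdgeHom (n + 2)) a})
        ?_ 1 ?_ z ?_
      · exact (Subgroup.mem_centralizer_singleton_iff.1 this)
      · exact (h.cycles_le_center h₀ _).trans (Subgroup.center_le_centralizer _)
      · intro j w hj hw
        obtain ⟨j, rfl⟩ : ∃ j' : Fin (n + 1), j = j'.succ :=
          ⟨⟨j.val - 1, by omega⟩, by ext; simp only [Fin.val_succ]; omega⟩
        rw [Subgroup.mem_centralizer_singleton_iff, ← σ_succ_initialEdgeHom j, ← act_act,
          ← map_mul, ← map_mul]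
        refine congrArg _ (ih _ _ ?_ (face_zero_act_initialEdgeHom h₀ a))
        rw [Fin.castSucc_succ, face_face (Fin.zero_le _), Fin.castSucc_zero, hw 0 (by simp),
          map_one]
      · intro i hi
        rw [show i = 0 from Fin.ext (by simpa using hi)]
        exact hz
    have hsup : (C ⊓ L) ⊔ (degen G (0 : Fin (n + 2))).range = ⊤ := by
      rw [eq_top_iff, ← h.closure_act_eq_top h₀ hcomm (n + 1), Subgroup.closure_le]
      rintro _ ⟨θ, a, rfl⟩
      rcases eq_initialEdgeHom_or θ with hθ | hθ
      · rw [hθ]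
        exact Subgroup.mem_sup_left ⟨hedge a, face_zero_act_initialEdgeHom h₀ a⟩
      · rw [hθ, ← act_act]
        exact Subgroup.mem_sup_right ⟨_, rfl⟩
    have hmem : x ∈ (C ⊓ L) ⊔ (degen G (0 : Fin (n + 2))).range := hsup ▸ Subgroup.mem_top x
    obtain ⟨c, hc, _, ⟨z, rfl⟩, rfl⟩ := Subgroup.mem_sup_of_normal_left.1 hmem
    have hz : z = 1 := by
      rw [map_mul, face_zero_degen_zero, MonoidHom.mem_ker.1 hc.2, one_mul] at hx
      exact hx
    rw [hz, map_one, mul_one]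
    exact (Subgroup.mem_centralizer_iff.1 hc.1 y hy).symm

/-! ### The simplicial abelian group structure transported from the classifying complex -/

variable (G) in
/-- The elements with trivial `d_0` commute; for reduced `G` this says that `ΩG` is abelian. -/
def LoopCommutative : Prop :=
  ∀ (n : ℕ) (x y : G _⦋n + 1⦌), face G 0 x = 1 → face G 0 y = 1 → x * y = y * x

/-- The twisting function `τ(x) = x (s_0 d_0 x)⁻¹` with values in the elements with trivial
`d_0`. -/
def twist {n : ℕ} (x : G _⦋n + 1⦌) : G _⦋n + 1⦌ := x * (degen G 0 (face G 0 x))⁻¹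

lemma face_zero_twist {n : ℕ} (x : G _⦋n + 1⦌) : face G 0 (twist x) = 1 := by
  rw [twist, map_mul, map_inv, face_zero_degen_zero, mul_inv_cancel]

lemma twist_mul_degen {n : ℕ} (x : G _⦋n + 1⦌) : twist x * degen G 0 (face G 0 x) = x :=
  inv_mul_cancel_right _ _

lemma eq_of_twist_eq {n : ℕ} {x y : G _⦋n + 1⦌} (ht : twist x = twist y)
    (hf : face G 0 x = face G 0 y) : x = y := by
  rw [← twist_mul_degen x, ← twist_mul_degen y, ht, hf]

lemma face_zero_mul_degen {n : ℕ} {t : G _⦋n + 1⦌} (ht : face G 0 t = 1) (z : G _⦋n⦌) :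
    face G 0 (t * degen G 0 z) = z := by
  rw [map_mul, ht, one_mul, face_zero_degen_zero]

lemma twist_mul_degen_zero {n : ℕ} {t : G _⦋n + 1⦌} (ht : face G 0 t = 1) (z : G _⦋n⦌) :
    twist (t * degen G 0 z) = t := by
  rw [twist, face_zero_mul_degen ht, mul_inv_cancel_right]

lemma twist_eq_self {n : ℕ} {x : G _⦋n + 1⦌} (hx : face G 0 x = 1) : twist x = x := by
  rw [twist, hx, map_one, inv_one, mul_one]

lemma twist_degen_zero {n : ℕ} (x : G _⦋n⦌) : twist (degen G 0 x) = 1 := by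
  rw [twist, face_zero_degen_zero, mul_inv_cancel]

lemma face_zero_degen_succ {n : ℕ} (j : Fin (n + 1)) (x : G _⦋n + 1⦌) :
    face G 0 (degen G j.succ x) = degen G j (face G 0 x) :=
  face_degen_of_le (i := 0) (Fin.zero_le _) x

lemma twist_degen_succ {n : ℕ} (j : Fin (n + 1)) (x : G _⦋n + 1⦌) :
    twist (degen G j.succ x) = degen G j.succ (twist x) := by
  rw [twist, face_zero_degen_succ, twist, map_mul, map_inv,
    ← degen_degen (Fin.zero_le j) (face G 0 x)]
  rfl

lemma face_zero_face_succ {n : ℕ} (j : Fin (n + 2)) (x : G _⦋n + 2⦌) :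
    face G 0 (face G j.succ x) = face G j (face G 0 x) :=
  face_face (i := 0) (Fin.zero_le _) x

lemma twist_face_succ_succ {n : ℕ} (j : Fin (n + 1)) (x : G _⦋n + 2⦌) :
    twist (face G j.succ.succ x) = face G j.succ.succ (twist x) := by
  rw [twist, face_zero_face_succ, twist, map_mul, map_inv,
    ← face_degen_of_gt (j := 0) (by simp [Fin.lt_def]) (face G 0 x)]
  rfl

lemma twist_face_one {n : ℕ} (x : G _⦋n + 2⦌) :
    twist (face G (Fin.succ 0) x) = face G (Fin.succ 0) (twist x) * twist (face G 0 x) := by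
  conv_lhs => rw [twist, face_zero_face_succ]
  rw [twist, twist, map_mul, map_inv, face_degen_succ, ← mul_assoc, inv_mul_cancel_right]

/-- The componentwise product with respect to the bijection `G_n ≃ ∏_k (ΩG)_k` (`k < n`) given by
`x ↦ (τ(x), τ(d_0 x), τ(d_0 d_0 x), …)`. This bijection identifies `G` with the classifying complex
`W̄(ΩG)`. -/
def compMul (n : ℕ) (x y : G _⦋n⦌) : G _⦋n⦌ :=
  match n, x, y with
  | 0, x, y => x * y
  | n + 1, x, y => twist x * twist y * degen G 0 (compMul n (face G 0 x) (face G 0 y))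

/-- The componentwise inverse with respect to the decomposition used in `compMul`. -/
def compInv (n : ℕ) (x : G _⦋n⦌) : G _⦋n⦌ :=
  match n, x with
  | 0, x => x⁻¹
  | n + 1, x => (twist x)⁻¹ * degen G 0 (compInv n (face G 0 x))

lemma face_zero_twist_mul {n : ℕ} (x y : G _⦋n + 1⦌) : face G 0 (twist x * twist y) = 1 := by
  rw [map_mul, face_zero_twist, face_zero_twist, one_mul]

lemma face_zero_compMul {n : ℕ} (x y : G _⦋n + 1⦌) :
    face G 0 (compMul (n + 1) x y) = compMul n (face G 0 x) (face G 0 y) :=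
  face_zero_mul_degen (face_zero_twist_mul x y) _

lemma twist_compMul {n : ℕ} (x y : G _⦋n + 1⦌) :
    twist (compMul (n + 1) x y) = twist x * twist y :=
  twist_mul_degen_zero (face_zero_twist_mul x y) _

lemma face_zero_twist_inv {n : ℕ} (x : G _⦋n + 1⦌) : face G 0 (twist x)⁻¹ = 1 := by
  rw [map_inv, face_zero_twist, inv_one]

lemma face_zero_compInv {n : ℕ} (x : G _⦋n + 1⦌) :
    face G 0 (compInv (n + 1) x) = compInv n (face G 0 x) :=
  face_zero_mul_degen (face_zero_twist_inv x) _

lemma twist_compInv {n : ℕ} (x : G _⦋n + 1⦌) : twist (compInv (n + 1) x) = (twist x)⁻¹ :=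
  twist_mul_degen_zero (face_zero_twist_inv x) _

lemma compMul_assoc (n : ℕ) (x y z : G _⦋n⦌) : compMul n (compMul n x y) z = compMul n x (compMul n y z) := by
  induction n with
  | zero => exact mul_assoc x y z
  | succ n ih =>
    apply eq_of_twist_eq
    · rw [twist_compMul, twist_compMul, twist_compMul, twist_compMul, mul_assoc]
    · rw [face_zero_compMul, face_zero_compMul, face_zero_compMul, face_zero_compMul, ih]

lemma twist_one {n : ℕ} : twist (1 : G _⦋n + 1⦌) = 1 := twist_eq_self (map_one _)

lemma one_compMul (n : ℕ) (x : G _⦋n⦌) : compMul n 1 x = x := by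
  induction n with
  | zero => exact one_mul x
  | succ n ih =>
    apply eq_of_twist_eq
    · rw [twist_compMul, twist_one, one_mul]
    · rw [face_zero_compMul, map_one, ih]

lemma compInv_compMul (n : ℕ) (x : G _⦋n⦌) : compMul n (compInv n x) x = 1 := by
  induction n with
  | zero => exact inv_mul_cancel x
  | succ n ih =>
    apply eq_of_twist_eq
    · rw [twist_compMul, twist_compInv, inv_mul_cancel, twist_one]
    · rw [face_zero_compMul, face_zero_compInv, ih, map_one]

lemma LoopCommutative.compMul_comm (hL : LoopCommutative G) (h₀ : Subsingleton (G _⦋0⦌)) (n : ℕ)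
    (x y : G _⦋n⦌) : compMul n x y = compMul n y x := by
  induction n with
  | zero => exact Subsingleton.elim _ _
  | succ n ih =>
    apply eq_of_twist_eq
    · rw [twist_compMul, twist_compMul, hL n _ _ (face_zero_twist x) (face_zero_twist y)]
    · rw [face_zero_compMul, face_zero_compMul, ih]

lemma compMul_eq_mul {n : ℕ} {x y : G _⦋n + 1⦌} (hx : face G 0 x = 1) (hy : face G 0 y = 1) :
    compMul (n + 1) x y = x * y := by
  rw [compMul, twist_eq_self hx, twist_eq_self hy, hx, hy, one_compMul, map_one, mul_one]

lemma compMul_degen {n : ℕ} (j : Fin (n + 1)) (x y : G _⦋n⦌) :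
    degen G j (compMul n x y) = compMul (n + 1) (degen G j x) (degen G j y) := by
  have hzero : ∀ {n : ℕ} (x y : G _⦋n⦌),
      degen G 0 (compMul n x y) = compMul (n + 1) (degen G 0 x) (degen G 0 y) := by
    intro n x y
    apply eq_of_twist_eq
    · rw [twist_compMul, twist_degen_zero, twist_degen_zero, twist_degen_zero, one_mul]
    · rw [face_zero_compMul, face_zero_degen_zero, face_zero_degen_zero, face_zero_degen_zero]
  induction n with
  | zero =>
    obtain rfl : j = 0 := Fin.ext (by omega)
    exact hzero x y
  | succ n ih =>
    induction j using Fin.cases with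
    | zero => exact hzero x y
    | succ j =>
      apply eq_of_twist_eq
      · rw [twist_compMul, twist_degen_succ, twist_degen_succ, twist_degen_succ, twist_compMul, map_mul]
      · rw [face_zero_compMul, face_zero_degen_succ, face_zero_degen_succ, face_zero_degen_succ,
          face_zero_compMul, ih]

/-- Faces are homomorphisms for the componentwise product. Commutativity of the loop group is
needed for `d_1`, which multiplies two adjacent components. -/
lemma LoopCommutative.compMul_face (hL : LoopCommutative G) (h₀ : Subsingleton (G _⦋0⦌)) {n : ℕ}
    (i : Fin (n + 2)) (x y : G _⦋n + 1⦌) :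
    face G i (compMul (n + 1) x y) = compMul n (face G i x) (face G i y) := by
  induction n with
  | zero => exact Subsingleton.elim _ _
  | succ n ih =>
    induction i using Fin.cases with
    | zero => exact face_zero_compMul x y
    | succ i =>
      apply eq_of_twist_eq
      · induction i using Fin.cases with
        | zero =>
          have h1 : face G 0 (face G (Fin.succ 0) (twist y)) = 1 := by
            rw [face_zero_face_succ, face_zero_twist, map_one]
          rw [twist_compMul, twist_face_one, twist_face_one, twist_face_one, twist_compMul,
            face_zero_compMul, twist_compMul, map_mul]
          rw [mul_assoc, mul_assoc, ← mul_assoc (twist (face G 0 x)),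
            hL n (twist (face G 0 x)) _ (face_zero_twist _) h1, mul_assoc]
        | succ i =>
          rw [twist_compMul, twist_face_succ_succ, twist_face_succ_succ, twist_face_succ_succ,
            twist_compMul, map_mul]
      · rw [face_zero_compMul, face_zero_face_succ, face_zero_face_succ, face_zero_face_succ,
          face_zero_compMul, ih]

lemma LoopCommutative.compMul_act (hL : LoopCommutative G) (h₀ : Subsingleton (G _⦋0⦌)) {m n : ℕ}
    (θ : ⦋m⦌ ⟶ ⦋n⦌) (x y : G _⦋n⦌) :
    act G θ (compMul n x y) = compMul m (act G θ x) (act G θ y) := by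
  let W : MorphismProperty SimplexCategory := fun a b θ =>
    ∀ x y : G _⦋b.len⦌, act G (m := a.len) (n := b.len) θ (compMul b.len x y) =
      compMul a.len (act G (m := a.len) (n := b.len) θ x) (act G (m := a.len) (n := b.len) θ y)
  have hW : W.IsMultiplicative :=
    { id_mem := fun a x y => by
        have e := act_id (G := G) (n := a.len)
        exact (e _).trans (congrArg₂ _ (e x).symm (e y).symm)
      comp_mem := fun {a b c} f g hf hg x y => by
        have e := act_act (G := G) (l := a.len) (m := b.len) (n := c.len) f g
        exact (e _).symm.trans ((congrArg _ (hg x y)).trans ((hf _ _).trans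
          (congrArg₂ _ (e x) (e y)))) }
  have htop : W = ⊤ := SimplexCategory.morphismProperty_eq_top W
    (fun i => hL.compMul_face h₀ i) (fun j => compMul_degen j)
  have : W θ := by rw [htop]; trivial
  exact this x y

/-- The set `G_n`, to be endowed with the componentwise group structure instead of the given
one. -/
def LoopCommutative.Carrier (_ : LoopCommutative G) (_ : Subsingleton (G _⦋0⦌)) (n : ℕ) : Type u :=
  G _⦋n⦌

/-- The componentwise group structure on `G_n`. -/
instance LoopCommutative.commGroup (hL : LoopCommutative G) (h₀ : Subsingleton (G _⦋0⦌)) (n : ℕ) :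
    CommGroup (hL.Carrier h₀ n) :=
  letI : Mul (hL.Carrier h₀ n) := ⟨compMul (G := G) n⟩
  letI : Inv (hL.Carrier h₀ n) := ⟨compInv (G := G) n⟩
  letI : One (hL.Carrier h₀ n) := ⟨(1 : G _⦋n⦌)⟩
  { Group.ofLeftAxioms (G := hL.Carrier h₀ n) (compMul_assoc (G := G) n) (one_compMul (G := G) n)
      (compInv_compMul (G := G) n) with
    mul_comm := hL.compMul_comm h₀ n }

/-- The simplicial abelian group with the same underlying simplicial set as `G` and the
componentwise group structure. -/
def LoopCommutative.straighten (hL : LoopCommutative G) (h₀ : Subsingleton (G _⦋0⦌)) :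
    SimplicialObject CommGrpCat.{u} where
  obj k := CommGrpCat.of (hL.Carrier h₀ k.unop.len)
  map {k l} θ := CommGrpCat.ofHom
    { toFun := act G (m := l.unop.len) (n := k.unop.len) θ.unop
      map_one' := map_one (act G (m := l.unop.len) (n := k.unop.len) θ.unop)
      map_mul' := hL.compMul_act h₀ (m := l.unop.len) (n := k.unop.len) θ.unop }
  map_id k := CommGrpCat.ext fun x => act_id (G := G) (n := k.unop.len) x
  map_comp {k l m} θ η := CommGrpCat.ext fun x =>
    (act_act (G := G) (l := m.unop.len) (m := l.unop.len) (n := k.unop.len) η.unop θ.unop x).symm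

lemma LoopCommutative.faceTrivial_straighten (hL : LoopCommutative G)
    (h₀ : Subsingleton (G _⦋0⦌)) (h : FaceTrivial G) :
    FaceTrivial (ofComm (hL.straighten h₀)) := h

/-- On cycles of positive dimension the componentwise product is the original one. -/
def LoopCommutative.cyclesEquiv (hL : LoopCommutative G) (h₀ : Subsingleton (G _⦋0⦌)) (n : ℕ) :
    cycles (ofComm (hL.straighten h₀)) (n + 1) ≃* cycles G (n + 1) where
  toFun x := ⟨x.1, (mem_cycles_succ (G := G)).2
    ((mem_cycles_succ (G := ofComm (hL.straighten h₀))).1 x.2)⟩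
  invFun x := ⟨x.1, (mem_cycles_succ (G := ofComm (hL.straighten h₀))).2
    ((mem_cycles_succ (G := G)).1 x.2)⟩
  left_inv _ := rfl
  right_inv _ := rfl
  map_mul' x y := Subtype.ext <|
    compMul_eq_mul (G := G) ((mem_cycles_succ (G := ofComm (hL.straighten h₀))).1 x.2 0)
      ((mem_cycles_succ (G := ofComm (hL.straighten h₀))).1 y.2 0)

/-- The identity isomorphism between the underlying simplicial sets. -/
def LoopCommutative.straightenIso (hL : LoopCommutative G) (h₀ : Subsingleton (G _⦋0⦌)) :
    toSSet (ofComm (hL.straighten h₀)) ≅ toSSet G :=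
  NatIso.ofComponents (fun _ => Iso.refl _) (fun _ => rfl)

/-! ### Degenerate elements and cycles in a simplicial abelian group -/

variable (G) in
/-- The subgroup of `G_{n+1}` generated by the images of the degeneracies `s_j` with `m ≤ j`. -/
def degenFrom (n m : ℕ) : Subgroup (G _⦋n + 1⦌) :=
  Subgroup.closure {x | ∃ (j : Fin (n + 1)) (y : G _⦋n⦌), m ≤ j.val ∧ degen G j y = x}

/-- The endomorphism `1 - s_j d_j` (in multiplicative notation) of a commutative `G_{n+1}`. -/
def normalization (hc : ∀ (n : ℕ) (x y : G _⦋n⦌), x * y = y * x) {n : ℕ} (j : Fin (n + 1)) :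
    G _⦋n + 1⦌ →* G _⦋n + 1⦌ :=
  MonoidHom.mk' (fun x => x * (degen G j (face G j.castSucc x))⁻¹) fun x y => by
    rw [map_mul, map_mul, mul_inv_rev, mul_assoc x y, ← mul_assoc y, hc _ (y * _), mul_assoc]

lemma normalization_degen_mem (hc : ∀ (n : ℕ) (x y : G _⦋n⦌), x * y = y * x) {n : ℕ}
    (k : Fin (n + 1)) {x : G _⦋n + 1⦌} (hx : x ∈ degenFrom G n k.val) :
    normalization hc k x ∈ degenFrom G n (k.val + 1) := by
  rw [← Subgroup.mem_comap]
  refine (Subgroup.closure_le _).2 ?_ hx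
  rintro _ ⟨j, y, hj, rfl⟩
  change degen G j y * (degen G k (face G k.castSucc (degen G j y)))⁻¹ ∈ degenFrom G n (k.val + 1)
  rcases hj.eq_or_lt with hj | hj
  · obtain rfl : k = j := Fin.ext hj
    rw [face_degen_self, mul_inv_cancel]
    exact one_mem _
  · obtain ⟨n, rfl⟩ : ∃ m, n = m + 1 := ⟨n - 1, by omega⟩
    obtain ⟨j, rfl⟩ : ∃ j' : Fin (n + 1), j = j'.succ :=
      ⟨⟨j.val - 1, by omega⟩, by ext; simp only [Fin.val_succ]; omega⟩
    obtain ⟨k, rfl⟩ : ∃ k' : Fin (n + 1), k = k'.castSucc :=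
      ⟨⟨k.val, by omega⟩, rfl⟩
    simp only [Fin.val_succ, Fin.val_castSucc] at hj
    rw [face_degen_of_le (by rw [Fin.le_def]; simp only [Fin.val_castSucc]; omega),
      degen_degen (by rw [Fin.le_def]; omega), ← map_inv, ← map_mul]
    exact Subgroup.subset_closure ⟨_, _, by simp only [Fin.val_succ, Fin.val_castSucc]; omega, rfl⟩

/-- In a simplicial abelian group, only the trivial cycle is a product of degenerate elements:
`1 - s_k d_k` fixes cycles and sends products of elements `s_j y` with `j ≥ k` to such products
with `j ≥ k + 1`. -/
lemma eq_one_of_mem_degenFrom (hc : ∀ (n : ℕ) (x y : G _⦋n⦌), x * y = y * x) {n : ℕ}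
    {x : G _⦋n + 1⦌} (hx : x ∈ cycles G (n + 1)) (hd : x ∈ degenFrom G n 0) : x = 1 := by
  have key : ∀ m ≤ n + 1, x ∈ degenFrom G n m := by
    intro m
    induction m with
    | zero => exact fun _ => hd
    | succ m ih =>
      intro hm
      have h := normalization_degen_mem hc ⟨m, by omega⟩ (ih (by omega))
      change x * (degen G _ (face G _ x))⁻¹ ∈ _ at h
      rwa [mem_cycles_succ.1 hx, map_one, inv_one, mul_one] at h
  have hbot : degenFrom G n (n + 1) = ⊥ := by
    rw [degenFrom, Subgroup.closure_eq_bot_iff]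
    rintro _ ⟨j, y, hj, rfl⟩
    omega
  have := key (n + 1) le_rfl
  rwa [hbot, Subgroup.mem_bot] at this

/-! ### Splitting a minimal simplicial abelian group -/

variable (G) in
/-- The subgroup of `G_k` generated by the images of the `n`-dimensional cycles under the simplicial
operators. -/
def cycleSpan (n k : ℕ) : Subgroup (G _⦋k⦌) :=
  Subgroup.closure {x | ∃ (θ : ⦋k⦌ ⟶ ⦋n⦌) (z : G _⦋n⦌), z ∈ cycles G n ∧ act G θ z = x}

lemma act_mem_cycleSpan {n k l : ℕ} (θ : ⦋l⦌ ⟶ ⦋k⦌) {x : G _⦋k⦌} (hx : x ∈ cycleSpan G n k) :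
    act G θ x ∈ cycleSpan G n l := by
  rw [← Subgroup.mem_comap]
  refine (Subgroup.closure_le _).2 ?_ hx
  rintro _ ⟨η, z, hz, rfl⟩
  exact Subgroup.subset_closure ⟨θ ≫ η, z, hz, (act_act _ _ _).symm⟩

lemma cycles_le_cycleSpan (n : ℕ) : cycles G n ≤ cycleSpan G n n :=
  fun x hx => Subgroup.subset_closure ⟨𝟙 _, x, hx, act_id x⟩

lemma cycleSpan_eq_bot {n k : ℕ} (h : k < n + 1) : cycleSpan G (n + 1) k = ⊥ := by
  rw [cycleSpan, Subgroup.closure_eq_bot_iff]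
  rintro _ ⟨θ, z, hz, rfl⟩
  have hθ : ¬ Function.Surjective θ.toOrderHom := by
    intro hs
    have := Fintype.card_le_of_surjective _ hs
    simp only [Fintype.card_fin, SimplexCategory.len_mk] at this
    omega
  obtain ⟨i, η, rfl⟩ := SimplexCategory.eq_comp_δ_of_not_surjective θ hθ
  rw [← act_act (l := k) (m := n), mem_cycles_succ.1 hz, map_one]
  rfl

lemma cycleSpan_le_degenFrom {n k : ℕ} (h : n < k + 1) :
    cycleSpan G n (k + 1) ≤ degenFrom G k 0 := by
  rw [cycleSpan, Subgroup.closure_le]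
  rintro _ ⟨θ, z, hz, rfl⟩
  have hθ : ¬ Function.Injective θ.toOrderHom := by
    intro hs
    have := Fintype.card_le_of_injective _ hs
    simp only [Fintype.card_fin, SimplexCategory.len_mk] at this
    omega
  obtain ⟨i, η, rfl⟩ := SimplexCategory.eq_σ_comp_of_not_injective θ hθ
  rw [← act_act (l := k + 1) (m := k)]
  exact Subgroup.subset_closure ⟨i, _, Nat.zero_le _, rfl⟩

lemma eq_one_of_mem_cycleSpan (hc : ∀ (n : ℕ) (x y : G _⦋n⦌), x * y = y * x) {n k : ℕ}
    (hnk : k ≠ n + 1) {x : G _⦋k⦌} (hx : x ∈ cycleSpan G (n + 1) k) (hz : x ∈ cycles G k) :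
    x = 1 := by
  rcases lt_or_gt_of_ne hnk with h | h
  · rwa [cycleSpan_eq_bot h, Subgroup.mem_bot] at hx
  · obtain ⟨k, rfl⟩ : ∃ k', k = k' + 1 := ⟨k - 1, by omega⟩
    exact eq_one_of_mem_degenFrom hc hz (cycleSpan_le_degenFrom h hx)

/-- The simplicial abelian subgroup generated by the `n`-dimensional cycles. -/
def cycleComponent (hc : ∀ (n : ℕ) (x y : G _⦋n⦌), x * y = y * x) (n : ℕ) :
    SimplicialObject CommGrpCat.{u} where
  obj k := @CommGrpCat.of (cycleSpan G n k.unop.len)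
    { (inferInstance : Group (cycleSpan G n k.unop.len)) with
      mul_comm := fun _ _ => Subtype.ext (hc _ _ _) }
  map {k l} θ := @CommGrpCat.ofHom _ _ (_) (_)
    (((act G (m := l.unop.len) (n := k.unop.len) θ.unop).comp
      (cycleSpan G n k.unop.len).subtype).codRestrict (cycleSpan G n l.unop.len)
        fun x => act_mem_cycleSpan (k := k.unop.len) (l := l.unop.len) θ.unop x.2)
  map_id k := CommGrpCat.ext fun x => Subtype.ext <|
    act_id (G := G) (n := k.unop.len) x.1
  map_comp {k l m} θ η := CommGrpCat.ext fun x => Subtype.ext <|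
    (act_act (G := G) (l := m.unop.len) (m := l.unop.len) (n := k.unop.len) η.unop θ.unop x.1).symm

section Component

variable (hc : ∀ (n : ℕ) (x y : G _⦋n⦌), x * y = y * x)

lemma mem_cycles_cycleComponent {n k : ℕ} (x : cycleSpan G n k) :
    x ∈ cycles (ofComm (cycleComponent hc n)) k ↔ x.1 ∈ cycles G k := by
  cases k with
  | zero => exact Iff.rfl
  | succ k =>
    refine (mem_cycles_succ (G := ofComm (cycleComponent hc n))).trans
      (Iff.trans ?_ (mem_cycles_succ (G := G)).symm)
    exact forall_congr' fun i => Subtype.ext_iff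

lemma FaceTrivial.cycleComponent (h : FaceTrivial G) (n : ℕ) :
    FaceTrivial (ofComm (cycleComponent hc n)) := fun m k x hx =>
  Subtype.ext (h m k x.1 fun i hi => congrArg Subtype.val (hx i hi))

/-- The `n`-dimensional cycles of the subgroup they generate. -/
def cyclesCycleComponentEquiv (n : ℕ) :
    cycles (ofComm (cycleComponent hc n)) n ≃* cycles G n where
  toFun x := ⟨x.1.1, (mem_cycles_cycleComponent hc x.1).1 x.2⟩
  invFun x := ⟨⟨x.1, cycles_le_cycleSpan n x.2⟩, (mem_cycles_cycleComponent hc _).2 x.2⟩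
  left_inv _ := rfl
  right_inv _ := rfl
  map_mul' _ _ := rfl

/-- In a minimal simplicial abelian group, the cycles of dimension `n + 1` generate an
Eilenberg-MacLane space. -/
lemma FaceTrivial.isEilenbergMacLane_cycleComponent (h : FaceTrivial G) (n : ℕ) {A : Type v}
    [Group A] (e : cycles G (n + 1) ≃* A) :
    IsEilenbergMacLane (ofComm (SimplicialGroup.cycleComponent hc (n + 1))) A (n + 1) := by
  refine ⟨⟨((h.cycleComponent hc (n + 1)).homotopyGroupEquiv (n + 1)).trans
    ((cyclesCycleComponentEquiv hc (n + 1)).trans e)⟩, fun m hm => ?_⟩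
  refine ((h.cycleComponent hc (n + 1)).homotopyGroupEquiv m).toEquiv.subsingleton_congr.2 ?_
  refine subsingleton_of_forall_eq 1 fun x => Subtype.ext (Subtype.ext ?_)
  exact eq_one_of_mem_cycleSpan hc hm x.1.2 ((mem_cycles_cycleComponent hc x.1).1 x.2)

/-- The product of the first `m` components of a family. -/
def partialProd (m k : ℕ) : (∀ n : ℕ, cycleSpan G (n + 1) k) →* G _⦋k⦌ :=
  MonoidHom.mk' (fun x => ((List.range m).map fun n => (x n).1).prod) fun x y => by
    induction m with
    | zero => simp
    | succ m ih =>
      simp only [List.range_succ, List.map_append, List.prod_append, List.map_singleton,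
        List.prod_singleton]
      rw [ih, mul_assoc, mul_assoc, ← mul_assoc (x m).1, hc _ (x m).1, mul_assoc]
      rfl

lemma partialProd_succ (m k : ℕ) (x : ∀ n : ℕ, cycleSpan G (n + 1) k) :
    partialProd hc (m + 1) k x = partialProd hc m k x * (x m).1 := by
  change ((List.range (m + 1)).map fun n => (x n).1).prod = _
  rw [List.range_succ, List.map_append, List.prod_append, List.map_singleton, List.prod_singleton]
  rfl

lemma partialProd_eq_one (m k : ℕ) (x : ∀ n : ℕ, cycleSpan G (n + 1) k)
    (hx : ∀ n < m, x n = 1) : partialProd hc m k x = 1 := by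
  induction m with
  | zero => rfl
  | succ m ih =>
    rw [partialProd_succ, ih fun n hn => hx n (by omega), hx m (by omega), one_mul]
    rfl

lemma partialProd_of_le {m k : ℕ} (h : k ≤ m) (x : ∀ n : ℕ, cycleSpan G (n + 1) k) :
    partialProd hc m k x = partialProd hc k k x := by
  induction m, h using Nat.le_induction with
  | base => rfl
  | succ m hm ih =>
    have hxm : (x m).1 = 1 :=
      Subgroup.mem_bot.1 ((cycleSpan_eq_bot (by omega : k < m + 1)).le (x m).2)
    rw [partialProd_succ, ih, hxm, mul_one]

/-- The action of a simplicial operator on families of elements of the components. -/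
def actFamily {k l : ℕ} (θ : ⦋l⦌ ⟶ ⦋k⦌) (x : ∀ n : ℕ, cycleSpan G (n + 1) k) (n : ℕ) :
    cycleSpan G (n + 1) l :=
  ⟨act G θ (x n).1, act_mem_cycleSpan θ (x n).2⟩

lemma act_partialProd {k l : ℕ} (θ : ⦋l⦌ ⟶ ⦋k⦌) (x : ∀ n : ℕ, cycleSpan G (n + 1) k) :
    act G θ (partialProd hc k k x) = partialProd hc l l (actFamily θ x) := by
  have h : ∀ m, act G θ (partialProd hc m k x) = partialProd hc m l (actFamily θ x) := by
    intro m
    induction m with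
    | zero => exact map_one _
    | succ m ih =>
      rw [partialProd_succ, partialProd_succ, map_mul, ih]
      rfl
  rw [← partialProd_of_le hc (le_max_left k l), h, partialProd_of_le hc (le_max_right k l)]

lemma FaceTrivial.partialProd_surjective (h : FaceTrivial G) (h₀ : Subsingleton (G _⦋0⦌)) (k : ℕ) :
    Function.Surjective (partialProd hc k k) := by
  induction k with
  | zero => exact fun x => ⟨1, Subsingleton.elim _ _⟩
  | succ k ih =>
    intro x
    refine h.mem_of_face_eq_one (partialProd hc (k + 1) (k + 1)).range ?_ 0 ?_ x (by simp)
    · intro z hz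
      refine ⟨Pi.mulSingle k ⟨z, cycles_le_cycleSpan _ hz⟩, ?_⟩
      rw [partialProd_succ, partialProd_eq_one, one_mul, Pi.mulSingle_eq_same]
      exact fun n hn => Pi.mulSingle_eq_of_ne (by omega) _
    · intro j y _ _
      obtain ⟨w, hw⟩ := ih (face G j.castSucc y)
      exact ⟨_, by rw [← hw, act_partialProd]⟩

lemma partialProd_injective (h₀ : Subsingleton (G _⦋0⦌)) (k : ℕ) :
    Function.Injective (partialProd hc k k) := by
  induction k with
  | zero => exact fun x y _ => funext fun n => Subtype.ext (Subsingleton.elim _ _)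
  | succ k ih =>
    rw [injective_iff_map_eq_one]
    intro x hx
    have hface : ∀ n, (x n).1 ∈ cycles G (k + 1) := by
      intro n
      rw [mem_cycles_succ]
      intro i
      have : actFamily (SimplexCategory.δ i) x = 1 := by
        apply ih
        rw [← act_partialProd, hx, map_one, map_one]
      exact congrArg Subtype.val (congrFun this n)
    have hne : ∀ n, n ≠ k → x n = 1 := fun n hn =>
      Subtype.ext (eq_one_of_mem_cycleSpan hc (by omega) (x n).2 (hface n))
    funext n
    by_cases hn : n = k
    · subst hn
      rw [partialProd_succ, partialProd_eq_one hc _ _ _ fun m hm => hne m (by omega),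
        one_mul] at hx
      exact Subtype.ext hx
    · exact hne n hn

end Component

/-! ### Products of simplicial sets and the decomposition -/

lemma HomotopyEquivalent.of_iso {X Y : SSet.{u}} (e : X ≅ Y) : HomotopyEquivalent X Y := by
  refine ⟨e.hom, e.inv, ?_, ?_⟩
  · rw [e.hom_inv_id]
    exact ⟨SSet.RelativeMorphism.Homotopy.refl _⟩
  · rw [e.inv_hom_id]
    exact ⟨SSet.RelativeMorphism.Homotopy.refl _⟩

/-- The dimensionwise product of a sequence of simplicial sets. -/
def sequenceProduct (X : ℕ → SSet.{u}) : SSet.{u} where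
  obj k := ∀ n, (X n).obj k
  map θ := ↾fun x n => (X n).map θ (x n)
  map_id k := by
    ext x n
    exact ConcreteCategory.congr_hom ((X n).map_id k) (x n)
  map_comp θ η := by
    ext x n
    exact ConcreteCategory.congr_hom ((X n).map_comp θ η) (x n)

/-- The projection of the dimensionwise product onto a factor. -/
def sequenceProductProj (X : ℕ → SSet.{u}) (n : ℕ) : sequenceProduct X ⟶ X n where
  app k := ↾fun x : ∀ n, (X n).obj k => x n

/-- The dimensionwise product is the categorical product. -/
noncomputable def sequenceProductIso (X : ℕ → SSet.{u}) : sequenceProduct X ≅ ∏ᶜ X where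
  hom := Pi.lift (sequenceProductProj X)
  inv :=
    { app := fun k => ↾fun x n => (Pi.π X n).app k x
      naturality := fun k l θ => by
        ext x
        exact funext fun n => ConcreteCategory.congr_hom ((Pi.π X n).naturality θ) x }
  hom_inv_id := by
    ext k x
    exact funext fun n => ConcreteCategory.congr_hom
      (congrArg (fun f => NatTrans.app f k) (Pi.lift_π (sequenceProductProj X) n)) x
  inv_hom_id := by
    refine Pi.hom_ext _ _ fun n => ?_
    rw [Category.assoc, Pi.lift_π, Category.id_comp]
    rfl

/-- A minimal simplicial abelian group with trivial group of vertices is the product of the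
simplicial abelian subgroups generated by its cycles in the various dimensions. -/
noncomputable def FaceTrivial.cycleComponentIso (hc : ∀ (n : ℕ) (x y : G _⦋n⦌), x * y = y * x)
    (h : FaceTrivial G) (h₀ : Subsingleton (G _⦋0⦌)) :
    (∏ᶜ fun n : ℕ => toSSet (ofComm (SimplicialGroup.cycleComponent hc (n + 1)))) ≅ toSSet G :=
  (sequenceProductIso _).symm ≪≫
    NatIso.ofComponents
      (fun k => (Equiv.ofBijective (partialProd hc k.unop.len k.unop.len)
        ⟨partialProd_injective hc h₀ _, h.partialProd_surjective hc h₀ _⟩).toIso)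
      (fun {k l} θ => by
        ext x
        exact (act_partialProd hc (k := k.unop.len) (l := l.unop.len) θ.unop x).symm)

end SimplicialGroup

theorem proposition6p14 (G : SimplicialObject GrpCat.{u}) (π : Type v) [Group π] [IsCyclic π]
    (hG : SimplicialGroup.IsMinimal (SimplicialGroup.toSSet G))
    (hred : Subsingleton (G _⦋0⦌))
    (hab : SimplicialGroup.IsMinimal
      (SimplicialGroup.toSSet (SimplicialGroup.ofComm (SimplicialGroup.abelianization G))))
    (hK : SimplicialGroup.IsEilenbergMacLane
      (SimplicialGroup.ofComm (SimplicialGroup.abelianization G)) π 1) :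
    (∀ (n : ℕ) (x y : (SimplicialGroup.loop G) _⦋n⦌), x * y = y * x) ∧
    ∃ E : ℕ → SimplicialObject CommGrpCat.{u},
      (∀ n : ℕ, SimplicialGroup.IsEilenbergMacLane (SimplicialGroup.ofComm (E n))
        (SimplicialGroup.homotopyGroup G (n + 1)) (n + 1)) ∧
      SimplicialGroup.HomotopyEquivalent (SimplicialGroup.toSSet G)
        (∏ᶜ fun n : ℕ => SimplicialGroup.toSSet (SimplicialGroup.ofComm (E n))) := by
  have h := hG.faceTrivial
  have hL : SimplicialGroup.LoopCommutative G :=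
    h.commute_of_face_zero hred fun n =>
      SimplicialGroup.cycles_le_commutator (n + 1) hab.faceTrivial (hK.2 (n + 2) (by omega))
  refine ⟨fun n x y => Subtype.ext (hL n _ _ (MonoidHom.mem_ker.1 x.2.1)
    (MonoidHom.mem_ker.1 y.2.1)), ?_⟩
  have hA := hL.faceTrivial_straighten hred h
  have hc : ∀ (n : ℕ) (x y : (SimplicialGroup.ofComm (hL.straighten hred)) _⦋n⦌),
      x * y = y * x := fun n => mul_comm (G := hL.Carrier hred n)
  refine ⟨fun n => SimplicialGroup.cycleComponent hc (n + 1), fun n => ?_, ?_⟩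
  · exact hA.isEilenbergMacLane_cycleComponent hc n
      ((hL.cyclesEquiv hred n).trans (h.homotopyGroupEquiv (n + 1)).symm)
  · exact SimplicialGroup.HomotopyEquivalent.of_iso
      ((hL.straightenIso hred).symm ≪≫ (hA.cycleComponentIso hc hred).symm)
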